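/- Let $\mathbb F_q$ be a finite field with $q$ elements, $\overline{\mathbb F}_q$ an algebraic closure of it, and $G$ a finite group with $(|G|,q)=1$. A group code in $\mathbb F_q[G]$ is a two-sided ideal $C$ of $\mathbb F_q[G]$; its dual is $C^\perp=\{v\in\mathbb F_q[G] : \langle v,u\rangle=0 \text{ for all } u\in C\}$, where $\langle \sum_g a_g g,\sum_g b_g g\rangle=\sum_g a_g b_g$, and its hull is $h(C)=C\cap C^\perp$. Let $\mathrm{Irr}(G)$ be the set of isomorphism classes of irreducible representations $\rho:G\to GL_n(\overline{\mathbb F}_q)$, $n\ge 1$. The group $\mathrm{Gal}(\overline{\mathbb F}_q/\mathbb F_q)$ acts on $\mathrm{Irr}(G)$ by $\sigma(\rho)=\sigma\circ\rho$ (apply $\sigma$ to every matrix entry); let $[\rho]$ be the orbit of $\rho$ and $[\mathrm{Irr}(G)]$ the set of orbits. Let $d(\rho)$ be the dimension of $\rho$, let $s(\rho)$ be the cardinality of $[\rho]$, and let $\rho^*$ be the contragredient of $\rho$, $\rho^*(g)={}^t\rho(g)^{-1}$; $d(\rho)$, $s(\rho)$ and $[\rho^*]$ depend only on $[\rho]$.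 Then, for every positive integer $k$, there exists a group code $C$ in $\mathbb F_q[G]$ with $\dim_{\mathbb F_q}h(C)=k$ if and only if there is a subset $S\subseteq[\mathrm{Irr}(G)]$ such that 1. $\sum_{[\rho]\in S}s(\rho)\,d(\rho)^2=k$; 2. $[\rho^*]\notin S$ for every $[\rho]\in S$. -/

import Mathlib

noncomputable section

namespace GroupCode

/-! ### Linear codes in the group algebra -/

section Codes

variable {F G : Type*} [Field F] [Group G] [Fintype G]

/-- The Euclidean inner product on `F[G]`, with respect to the basis of group elements. -/
def euclid (u v : MonoidAlgebra F G) : F := ∑ g : G, u.coeff g * v.coeff g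

/-- The dual code `C^⊥ = {v | ⟨v, u⟩ = 0 for all u ∈ C}`. -/
def dualCode (C : Submodule F (MonoidAlgebra F G)) : Submodule F (MonoidAlgebra F G) where
  carrier := {v | ∀ u ∈ C, euclid v u = 0}
  zero_mem' := by
    intro u _
    simp [euclid]
  add_mem' := by
    intro a b ha hb u hu
    have h1 := ha u hu
    have h2 := hb u hu
    simp only [euclid] at h1 h2 ⊢
    simp [add_mul, Finset.sum_add_distrib, h1, h2]
  smul_mem' := by
    intro c a ha u hu
    have h1 := ha u hu
    simp only [euclid] at h1 ⊢
    simp [mul_assoc, ← Finset.mul_sum, h1]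

/-- The hull `C ∩ C^⊥`. -/
def hull (C : Submodule F (MonoidAlgebra F G)) : Submodule F (MonoidAlgebra F G) :=
  C ⊓ dualCode C

end Codes

/-! ### Matrix representations, Galois conjugation and contragredients -/

section Reps

variable {F K G : Type*} [Field F] [Field K] [Algebra F K] [Group G] {n : ℕ}

/-- The representation on `Kⁿ` given by a homomorphism `G → GL_n(K)`. -/
def toRep (ρ : G →* Matrix.GeneralLinearGroup (Fin n) K) : Representation K G (Fin n → K) where
  toFun g := Matrix.mulVecLin (ρ g : Matrix (Fin n) (Fin n) K)
  map_one' := by ext; simp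
  map_mul' g h := by ext; simp

/-- Irreducibility of `ρ : G → GL_n(K)`; this forces `n ≥ 1`. -/
def IsIrred (ρ : G →* Matrix.GeneralLinearGroup (Fin n) K) : Prop :=
  (toRep ρ).IsIrreducible

theorem isIrred_iff (ρ : G →* Matrix.GeneralLinearGroup (Fin n) K) :
    IsIrred ρ ↔ n ≠ 0 ∧ ∀ W : Submodule K (Fin n → K),
      (∀ g, ∀ v ∈ W, (ρ g : Matrix (Fin n) (Fin n) K).mulVec v ∈ W) → W = ⊥ ∨ W = ⊤ := by
  constructor
  · intro h
    have h' : IsSimpleOrder (Subrepresentation (toRep ρ)) := h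
    refine ⟨?_, fun W hW => ?_⟩
    · rintro rfl
      obtain ⟨a, b, hab⟩ := h'.toNontrivial
      apply hab
      apply Subrepresentation.toSubmodule_injective
      exact Subsingleton.elim _ _
    · rcases h'.eq_bot_or_eq_top ⟨W, fun g v hv => hW g v hv⟩ with h1 | h1
      · left
        exact congrArg Subrepresentation.toSubmodule h1
      · right
        exact congrArg Subrepresentation.toSubmodule h1
  · rintro ⟨hn, h⟩
    have : NeZero n := ⟨hn⟩
    change IsSimpleOrder (Subrepresentation (toRep ρ))
    refine { exists_pair_ne := ⟨⊥, ⊤, ?_⟩, eq_bot_or_eq_top := ?_ }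
    · intro hbt
      have : (⊥ : Submodule K (Fin n → K)) = ⊤ := congrArg Subrepresentation.toSubmodule hbt
      exact bot_ne_top this
    · intro W
      rcases h W.toSubmodule (fun g v hv => W.apply_mem_toSubmodule g hv) with h1 | h1
      · left
        exact Subrepresentation.toSubmodule_injective h1
      · right
        exact Subrepresentation.toSubmodule_injective h1

/-- Galois conjugation `σ(ρ) = σ ∘ ρ`, with `σ` applied to every matrix entry. -/
def conj (σ : K ≃ₐ[F] K) (ρ : G →* Matrix.GeneralLinearGroup (Fin n) K) :
    G →* Matrix.GeneralLinearGroup (Fin n) K :=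
  (Matrix.GeneralLinearGroup.map (σ : K →+* K)).comp ρ

/-- The contragredient `ρ^*(g) = ᵗρ(g)⁻¹`. -/
def contra (ρ : G →* Matrix.GeneralLinearGroup (Fin n) K) :
    G →* Matrix.GeneralLinearGroup (Fin n) K where
  toFun g :=
    { val := ((ρ g)⁻¹ : Matrix.GeneralLinearGroup (Fin n) K).val.transpose
      inv := (ρ g).val.transpose
      val_inv := by
        rw [← Matrix.transpose_mul, ← Units.val_mul, mul_inv_cancel, Units.val_one,
          Matrix.transpose_one]
      inv_val := by
        rw [← Matrix.transpose_mul, ← Units.val_mul, inv_mul_cancel, Units.val_one,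
          Matrix.transpose_one] }
  map_one' := by
    apply Units.ext
    simp only [map_one, inv_one, Units.val_one, Matrix.transpose_one]
  map_mul' g h := by
    apply Units.ext
    simp only [map_mul, mul_inv_rev, Units.val_mul, Matrix.transpose_mul]

theorem isIrred_conj (σ : K ≃ₐ[F] K) {ρ : G →* Matrix.GeneralLinearGroup (Fin n) K}
    (h : IsIrred ρ) : IsIrred (conj σ ρ) := by
  rw [isIrred_iff] at h ⊢
  refine ⟨h.1, fun W hW => ?_⟩
  let W' : Submodule K (Fin n → K) :=
    { carrier := {v | (fun i => σ (v i)) ∈ W}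
      zero_mem' := by
        have e : (fun i => σ ((0 : Fin n → K) i) : Fin n → K) = 0 := by
          ext i
          simp
        change (fun i => σ ((0 : Fin n → K) i)) ∈ W
        rw [e]
        exact W.zero_mem
      add_mem' := by
        intro a b ha hb
        have e : (fun i => σ ((a + b) i) : Fin n → K) = (fun i => σ (a i)) + (fun i => σ (b i)) := by
          ext i
          simp
        change (fun i => σ ((a + b) i)) ∈ W
        rw [e]
        exact W.add_mem ha hb
      smul_mem' := by
        intro c a ha
        have e : (fun i => σ ((c • a) i) : Fin n → K) = σ c • (fun i => σ (a i)) := by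
          ext i
          simp
        change (fun i => σ ((c • a) i)) ∈ W
        rw [e]
        exact W.smul_mem (σ c) ha }
  have key : ∀ v : Fin n → K, (fun i => σ.symm (v i)) ∈ W' ↔ v ∈ W := by
    intro v
    change (fun i => σ (σ.symm (v i))) ∈ W ↔ v ∈ W
    simp
  have hinv : ∀ g, ∀ v ∈ W', (ρ g : Matrix (Fin n) (Fin n) K).mulVec v ∈ W' := by
    intro g v hv
    have := hW g _ hv
    change (fun i => σ ((ρ g : Matrix (Fin n) (Fin n) K).mulVec v i)) ∈ W
    convert! this using 1
    ext i
    simp [conj, Matrix.mulVec, dotProduct]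
  rcases h.2 W' hinv with h1 | h1
  · left
    rw [eq_bot_iff]
    intro v hv
    rw [← key, h1] at hv
    have h2 : (fun i => σ.symm (v i)) = 0 := hv
    rw [Submodule.mem_bot]
    ext i
    have := congrFun h2 i
    simpa using this
  · right
    rw [eq_top_iff]
    intro v _
    rw [← key, h1]
    trivial

theorem isIrred_contra {ρ : G →* Matrix.GeneralLinearGroup (Fin n) K}
    (h : IsIrred ρ) : IsIrred (contra ρ) := by
  rw [isIrred_iff] at h ⊢
  refine ⟨h.1, fun W hW => ?_⟩
  let B : LinearMap.BilinForm K (Fin n → K) := dotProductBilin K K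
  have hBapp : ∀ x y, B x y = x ⬝ᵥ y := fun x y => rfl
  have hB : B.Nondegenerate := by
    refine ⟨fun x hx => ?_, fun y hy => ?_⟩
    · ext i
      have := hx (Pi.single i 1)
      simpa [hBapp] using this
    · ext i
      have := hy (Pi.single i 1)
      simpa [hBapp] using this
  have hR : B.IsRefl := by
    intro x y hxy
    rw [hBapp] at hxy ⊢
    rwa [dotProduct_comm]
  have hinv : ∀ g, ∀ v ∈ B.orthogonal W,
      (ρ g : Matrix (Fin n) (Fin n) K).mulVec v ∈ B.orthogonal W := by
    intro g v hv w hw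
    have h1 := hv _ (hW g⁻¹ w hw)
    rw [hBapp] at h1 ⊢
    rw [Matrix.dotProduct_mulVec, ← Matrix.mulVec_transpose]
    simpa [contra] using h1
  rcases h.2 _ hinv with h1 | h1
  · right
    rw [← LinearMap.BilinForm.orthogonal_orthogonal hB hR W, h1,
      LinearMap.BilinForm.orthogonal_bot]
  · left
    rw [← LinearMap.BilinForm.orthogonal_orthogonal hB hR W, h1,
      LinearMap.BilinForm.orthogonal_top_eq_bot hB]

variable (K G) in
/-- Irreducible representations `G → GL_n(K)` up to isomorphism, `ρ₂ = T⁻¹ ρ₁ T`. -/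
def irrSetoid (n : ℕ) :
    Setoid {ρ : G →* Matrix.GeneralLinearGroup (Fin n) K // IsIrred ρ} where
  r ρ₁ ρ₂ := ∃ T : Matrix.GeneralLinearGroup (Fin n) K, ∀ g, ρ₂.1 g = T⁻¹ * ρ₁.1 g * T
  iseqv :=
    { refl := fun ρ => ⟨1, by simp⟩
      symm := by
        rintro a b ⟨T, hT⟩
        refine ⟨T⁻¹, fun g => ?_⟩
        rw [hT]
        group
      trans := by
        rintro a b c ⟨T, hT⟩ ⟨U, hU⟩
        refine ⟨T * U, fun g => ?_⟩
        rw [hU, hT]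
        group }

variable (K G) in
/-- The set `Irr(G)` of isomorphism classes of irreducible representations of `G` over `K`;
the first component of an element is its dimension. -/
def Irr : Type _ := Σ n : ℕ, Quotient (irrSetoid K G n)

/-- The dimension `d(ρ)`. -/
def Irr.dim (x : Irr K G) : ℕ := x.1

/-- The class in `Irr(G)` of an irreducible `ρ`. -/
def Irr.mk (ρ : G →* Matrix.GeneralLinearGroup (Fin n) K) (h : IsIrred ρ) : Irr K G :=
  ⟨n, Quotient.mk (irrSetoid K G n) ⟨ρ, h⟩⟩

/-- The action of the Galois group on `Irr(G)`, `σ • ρ = σ ∘ ρ`. -/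
instance instMulActionIrr : MulAction (K ≃ₐ[F] K) (Irr K G) where
  smul σ x := ⟨x.1, Quotient.map (sa := irrSetoid K G x.1) (sb := irrSetoid K G x.1)
    (fun ρ => ⟨conj σ ρ.1, isIrred_conj σ ρ.2⟩) (by
      rintro a b ⟨T, hT⟩
      refine ⟨Matrix.GeneralLinearGroup.map (σ : K →+* K) T, fun g => ?_⟩
      simp [conj, hT]) x.2⟩
  one_smul := by
    rintro ⟨n, x⟩
    induction x using Quotient.inductionOn with
    | h ρ =>
      change (⟨n, Quotient.mk (irrSetoid K G n) ⟨conj (1 : K ≃ₐ[F] K) ρ.1, _⟩⟩ : Irr K G) = _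
      congr 3
  mul_smul := by
    rintro σ τ ⟨n, x⟩
    induction x using Quotient.inductionOn with
    | h ρ => rfl

/-- The contragredient on `Irr(G)`. -/
def Irr.contra (x : Irr K G) : Irr K G :=
  ⟨x.1, Quotient.map (sa := irrSetoid K G x.1) (sb := irrSetoid K G x.1)
    (fun ρ => ⟨GroupCode.contra ρ.1, isIrred_contra ρ.2⟩) (by
      rintro a b ⟨T, hT⟩
      refine ⟨GroupCode.contra (MonoidHom.id _) T, fun g => ?_⟩
      have h1 : ∀ ρ : G →* Matrix.GeneralLinearGroup (Fin x.1) K,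
          GroupCode.contra ρ g = GroupCode.contra (MonoidHom.id _) (ρ g) := fun _ => rfl
      change GroupCode.contra b.1 g = _ * GroupCode.contra a.1 g * _
      rw [h1, h1, hT]
      simp) x.2⟩

theorem Irr.contra_smul (σ : K ≃ₐ[F] K) (x : Irr K G) : (σ • x).contra = σ • x.contra := by
  obtain ⟨n, x⟩ := x
  induction x using Quotient.inductionOn with
  | h ρ =>
    change Irr.mk (GroupCode.contra (conj σ ρ.1)) (isIrred_contra (isIrred_conj σ ρ.2)) =
      Irr.mk (conj σ (GroupCode.contra ρ.1)) (isIrred_conj σ (isIrred_contra ρ.2))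
    congr 1

variable (F K G) in
/-- The set `[Irr(G)]` of Galois orbits on `Irr(G)`. -/
abbrev IrrOrbit : Type _ := MulAction.orbitRel.Quotient (K ≃ₐ[F] K) (Irr K G)

/-- The cardinality `s(ρ)` of the orbit `[ρ]`. -/
def IrrOrbit.size (x : IrrOrbit F K G) : ℕ := Nat.card (MulAction.orbitRel.Quotient.orbit x)

/-- The common dimension `d(ρ)` of the members of the orbit `[ρ]`. -/
def IrrOrbit.dim (x : IrrOrbit F K G) : ℕ :=
  Quotient.liftOn' x Irr.dim (by
    rintro a b ⟨σ, rfl⟩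
    rfl)

/-- The orbit `[ρ^*]`. -/
def IrrOrbit.contra (x : IrrOrbit F K G) : IrrOrbit F K G :=
  Quotient.map' Irr.contra (by
    rintro a b ⟨σ, rfl⟩
    exact ⟨σ, (Irr.contra_smul σ b).symm⟩) x

end Reps

end GroupCode

end

/-! Write q for the order of `F` and * for the involution `g ↦ g⁻¹` of the group algebra. Since |G|
is prime to q, F[G] is semisimple, and a two-sided ideal is F[G]e with e a central idempotent. As
⟨v, u⟩ is the coefficient of 1 in v u*, the dual of F[G]e is {v : v e* = 0}. The hull is therefore
F[G]e(1 - e*), again generated by a central idempotent (`hull_fixedBy`).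

Over the algebraic closure K, evaluation identifies K[G] with the product of matrix algebras over
Irr(G) (`evalIrr_injective`, `evalIrr_surjective`). A central idempotent acts by 0 or 1 in each
factor, hence is given by the set of ρ where it acts by 1; it comes from F[G] exactly when this set
is Galois stable (`exists_central_idempotent_of_orbits`). So codes correspond to sets T of orbits,
of dimension ∑ s d² over T, dimensions being unchanged by passing from F to K
(`finrank_fixedBy_extendHom`).

Finally e* acts in ρ as the transpose of the action of e in ρ*, so the hull of T corresponds to {[ρ]
∈ T : [ρ*] ∉ T}. Such a set satisfies condition 2, and a set satisfying condition 2 is equal to its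
own hull. -/

namespace GroupCode

/-! ### Duals and hulls through the involution -/

section Involution

variable {F G : Type*} [Field F] [Group G]

/-- The linear involution `g ↦ g⁻¹` of the group algebra. -/
noncomputable def invol (a : MonoidAlgebra F G) : MonoidAlgebra F G :=
  MonoidAlgebra.mapDomain (·⁻¹) a

@[simp] theorem invol_single (g : G) (r : F) :
    invol (MonoidAlgebra.single g r) = MonoidAlgebra.single g⁻¹ r :=
  MonoidAlgebra.mapDomain_single

@[simp] theorem invol_zero : invol (0 : MonoidAlgebra F G) = 0 :=
  MonoidAlgebra.mapDomain_zero _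

@[simp] theorem invol_one : invol (1 : MonoidAlgebra F G) = 1 := by
  simp [MonoidAlgebra.one_def]

theorem invol_add (a b : MonoidAlgebra F G) : invol (a + b) = invol a + invol b :=
  MonoidAlgebra.mapDomain_add _ _ _

@[simp] theorem invol_invol (a : MonoidAlgebra F G) : invol (invol a) = a := by
  induction a using MonoidAlgebra.induction_linear with
  | zero => simp
  | add x y hx hy => rw [invol_add, invol_add, hx, hy]
  | single g r => simp

theorem invol_mul (a b : MonoidAlgebra F G) : invol (a * b) = invol b * invol a := by
  induction a using MonoidAlgebra.induction_linear with
  | zero => simp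
  | add x y hx hy => rw [add_mul, invol_add, invol_add, hx, hy, mul_add]
  | single g r =>
    induction b using MonoidAlgebra.induction_linear with
    | zero => simp
    | add x y hx hy => rw [mul_add, invol_add, invol_add, hx, hy, add_mul]
    | single h s => simp [MonoidAlgebra.single_mul_single, mul_comm]

theorem invol_mem_center {a : MonoidAlgebra F G} (ha : ∀ b, a * b = b * a)
    (b : MonoidAlgebra F G) : invol a * b = b * invol a := by
  have h := congrArg invol (ha (invol b))
  simpa only [invol_mul, invol_invol] using h.symm

theorem euclid_eq_coeff_one [Fintype G] (v u : MonoidAlgebra F G) :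
    euclid v u = (v * invol u).coeff 1 := by
  classical
  induction u using MonoidAlgebra.induction_linear with
  | zero => simp [euclid]
  | add x y hx hy =>
    rw [invol_add, mul_add, MonoidAlgebra.coeff_add, Finsupp.add_apply, ← hx, ← hy]
    simp [euclid, mul_add, Finset.sum_add_distrib]
  | single g r =>
    simp [euclid, Finsupp.single_apply]

theorem eq_zero_of_forall_euclid_eq_zero [Fintype G] {v : MonoidAlgebra F G}
    (h : ∀ u, euclid v u = 0) : v = 0 := by
  classical
  ext g
  simpa [euclid, Finsupp.single_apply] using h (MonoidAlgebra.single g 1)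

/-- The space `F[G] e`, as the set of elements fixed by right multiplication by an
idempotent `e`. -/
noncomputable def fixedBy (e : MonoidAlgebra F G) : Submodule F (MonoidAlgebra F G) :=
  LinearMap.ker (LinearMap.mulRight F e - LinearMap.id)

@[simp] theorem mem_fixedBy {e v : MonoidAlgebra F G} : v ∈ fixedBy e ↔ v * e = v := by
  simp [fixedBy, sub_eq_zero]

/-- Right multiplication by e is adjoint to right multiplication by `invol e`, and the form is
nondegenerate. -/
theorem mem_dualCode_fixedBy [Fintype G] {e : MonoidAlgebra F G} (he : e * e = e)
    {v : MonoidAlgebra F G} :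
    v ∈ dualCode (fixedBy e) ↔ v * invol e = 0 := by
  have key : ∀ u, euclid v (u * e) = euclid (v * invol e) u := by
    intro u
    rw [euclid_eq_coeff_one, euclid_eq_coeff_one, invol_mul, mul_assoc]
  constructor
  · intro hv
    refine eq_zero_of_forall_euclid_eq_zero fun u => ?_
    rw [← key]
    exact hv _ (by rw [mem_fixedBy, mul_assoc, he])
  · intro hv u hu
    rw [mem_fixedBy] at hu
    rw [← hu, key, hv, euclid_eq_coeff_one]
    simp

theorem hull_fixedBy [Fintype G] {e : MonoidAlgebra F G} (he : e * e = e)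
    (hc : ∀ b, e * b = b * e) :
    hull (fixedBy e) = fixedBy (e * (1 - invol e)) := by
  have hee : invol e * invol e = invol e := by rw [← invol_mul, he]
  ext v
  rw [hull, Submodule.mem_inf, mem_dualCode_fixedBy he, mem_fixedBy, mem_fixedBy]
  constructor
  · rintro ⟨h1, h2⟩
    rw [← mul_assoc, h1, mul_sub, h2, mul_one, sub_zero]
  · intro h
    constructor
    · conv_rhs => rw [← h]
      conv_lhs => rw [← h]
      rw [mul_assoc, mul_assoc, ← hc, ← mul_assoc e e, he]
    · rw [← h, mul_assoc, mul_assoc, sub_mul, one_mul, hee, sub_self, mul_zero, mul_zero]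

end Involution

/-- In a semisimple ring, every two-sided ideal is generated by a central idempotent. -/
theorem exists_central_idempotent {A : Type*} [Ring A] [IsSemisimpleRing A] (I : Ideal A)
    [I.IsTwoSided] :
    ∃ e : A, e * e = e ∧ (∀ b, e * b = b * e) ∧ ∀ x, x ∈ I ↔ x * e = x := by
  obtain ⟨e, he, hI⟩ := IsSemisimpleRing.ideal_eq_span_idempotent I
  have hmem : ∀ x, x ∈ I ↔ x * e = x := by
    intro x
    rw [hI, Ideal.mem_span_singleton']
    constructor
    · rintro ⟨a, rfl⟩
      rw [mul_assoc, he.eq]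
    · intro h
      exact ⟨x, h⟩
  have heI : e ∈ I := (hmem e).2 he.eq
  -- The defect n = x - e x is killed on the left by I. The left ideal of n is generated by an
  -- idempotent f = r n, and f = f f = (f r) n = 0 because f r lies in I; hence n = 0.
  have hleft : ∀ x ∈ I, e * x = x := by
    intro x hx
    set n := x - e * x with hn
    have hnI : n ∈ I := I.sub_mem hx (I.mul_mem_left e hx)
    have hen : e * n = 0 := by rw [hn, mul_sub, ← mul_assoc, he.eq, sub_self]
    have hann : ∀ y ∈ I, y * n = 0 := by
      intro y hy
      rw [← (hmem y).1 hy, mul_assoc, hen, mul_zero]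
    obtain ⟨f, hf, hJ⟩ := IsSemisimpleRing.ideal_eq_span_idempotent (Ideal.span {n})
    have hfn : f ∈ Ideal.span {n} := hJ ▸ Ideal.mem_span_singleton_self f
    have hnf : n ∈ Ideal.span {f} := hJ ▸ Ideal.mem_span_singleton_self n
    obtain ⟨r, hr⟩ := Ideal.mem_span_singleton'.1 hfn
    obtain ⟨s, hs⟩ := Ideal.mem_span_singleton'.1 hnf
    have hfI : f ∈ I := hr ▸ I.mul_mem_left r hnI
    have hf0 : f = 0 := by
      rw [← hf.eq]
      nth_rewrite 2 [← hr]
      rw [← mul_assoc]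
      exact hann _ (I.mul_mem_right r hfI)
    have : n = 0 := by rw [← hs, hf0, mul_zero]
    exact (sub_eq_zero.1 this).symm
  refine ⟨e, he.eq, fun b => ?_, hmem⟩
  -- With e a two-sided identity of I, e b = (e b) e = e (b e) = b e.
  rw [← (hmem _).1 (I.mul_mem_right b heI), mul_assoc, hleft _ (I.mul_mem_left b heI)]

/-! ### Matrix representations extended to the group algebra -/

section EvalRep

variable {K G : Type*} [Field K] [Group G] {n m : ℕ}

/-- The extension of a matrix representation to the group algebra. -/
noncomputable def evalRep (ρ : G →* Matrix.GeneralLinearGroup (Fin n) K) :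
    MonoidAlgebra K G →ₐ[K] Matrix (Fin n) (Fin n) K :=
  MonoidAlgebra.lift K _ G ((Units.coeHom _).comp ρ)

@[simp] theorem evalRep_single (ρ : G →* Matrix.GeneralLinearGroup (Fin n) K) (g : G) (r : K) :
    evalRep ρ (MonoidAlgebra.single g r) = r • (ρ g : Matrix (Fin n) (Fin n) K) := by
  simp [evalRep]

theorem evalRep_eq_of_equiv {ρ₁ ρ₂ : G →* Matrix.GeneralLinearGroup (Fin n) K}
    (T : Matrix.GeneralLinearGroup (Fin n) K) (hT : ∀ g, ρ₂ g = T⁻¹ * ρ₁ g * T)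
    (a : MonoidAlgebra K G) :
    evalRep ρ₂ a = (T⁻¹ : Matrix.GeneralLinearGroup (Fin n) K).val * evalRep ρ₁ a * T.val := by
  induction a using MonoidAlgebra.induction_linear with
  | zero => simp
  | add x y hx hy => rw [map_add, map_add, hx, hy, mul_add, add_mul]
  | single g r =>
    rw [evalRep_single, evalRep_single, hT, Units.val_mul, Units.val_mul]
    simp only [Matrix.mul_smul, Matrix.smul_mul]

theorem Irr.mk_eq_mk_iff {ρ₁ ρ₂ : G →* Matrix.GeneralLinearGroup (Fin n) K} (h₁ : IsIrred ρ₁)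
    (h₂ : IsIrred ρ₂) :
    Irr.mk ρ₁ h₁ = Irr.mk ρ₂ h₂ ↔
      ∃ T : Matrix.GeneralLinearGroup (Fin n) K, ∀ g, ρ₂ g = T⁻¹ * ρ₁ g * T := by
  constructor
  · intro h
    have h' := eq_of_heq (Sigma.mk.inj h).2
    exact Quotient.exact h'
  · intro h
    exact congrArg (Sigma.mk n) (Quotient.sound h)

theorem Irr.exists_eq_mk (x : Irr K G) :
    ∃ (ρ : G →* Matrix.GeneralLinearGroup (Fin x.dim) K) (h : IsIrred ρ), x = Irr.mk ρ h := by
  obtain ⟨n, x⟩ := x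
  induction x using Quotient.inductionOn with
  | h ρ => exact ⟨ρ.1, ρ.2, rfl⟩

/-- A representative of an element of `Irr(G)`. -/
noncomputable def Irr.rep (x : Irr K G) : G →* Matrix.GeneralLinearGroup (Fin x.dim) K :=
  x.exists_eq_mk.choose

theorem Irr.isIrred_rep (x : Irr K G) : IsIrred x.rep :=
  x.exists_eq_mk.choose_spec.choose

theorem Irr.mk_rep (x : Irr K G) : Irr.mk x.rep x.isIrred_rep = x :=
  x.exists_eq_mk.choose_spec.choose_spec.symm

/-- The chosen representative is only conjugate to ρ. Conjugation preserves equality of images,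
which is all that later arguments use. -/
theorem Irr.evalRep_mk_eq_iff {ρ : G →* Matrix.GeneralLinearGroup (Fin n) K} (h : IsIrred ρ)
    (a b : MonoidAlgebra K G) :
    evalRep (Irr.mk ρ h).rep a = evalRep (Irr.mk ρ h).rep b ↔ evalRep ρ a = evalRep ρ b := by
  obtain ⟨T, hT⟩ := (Irr.mk_eq_mk_iff _ _).1 (Irr.mk_rep (Irr.mk ρ h))
  change ∀ g, ρ g = T⁻¹ * (Irr.mk ρ h).rep g * T at hT
  have key : ∀ c, evalRep ρ c = (T⁻¹).val * evalRep (Irr.mk ρ h).rep c * T.val :=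
    evalRep_eq_of_equiv T hT
  rw [key a, key b]
  exact ((Units.mul_left_inj T).trans (Units.mul_right_inj T⁻¹)).symm

theorem mk_eq_mk_of_linearEquiv {ρ : G →* Matrix.GeneralLinearGroup (Fin n) K}
    {ρ' : G →* Matrix.GeneralLinearGroup (Fin m) K} (h : IsIrred ρ) (h' : IsIrred ρ')
    (T : (Fin n → K) ≃ₗ[K] (Fin m → K))
    (hT : ∀ g v, T ((ρ g : Matrix (Fin n) (Fin n) K).mulVec v) =
      (ρ' g : Matrix (Fin m) (Fin m) K).mulVec (T v)) :
    Irr.mk ρ h = Irr.mk ρ' h' := by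
  obtain rfl : n = m := by simpa using T.finrank_eq
  refine ((Irr.mk_eq_mk_iff h' h).2 ?_).symm
  let M : Matrix.GeneralLinearGroup (Fin n) K :=
    { val := LinearMap.toMatrix' T.toLinearMap
      inv := LinearMap.toMatrix' T.symm.toLinearMap
      val_inv := by rw [← LinearMap.toMatrix'_comp]; simp
      inv_val := by rw [← LinearMap.toMatrix'_comp]; simp }
  refine ⟨M, fun g => ?_⟩
  rw [mul_assoc, eq_inv_mul_iff_mul_eq]
  apply Units.ext
  rw [Units.val_mul, Units.val_mul]
  apply Matrix.toLin'.injective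
  refine LinearMap.ext fun v => ?_
  change Matrix.toLin' (LinearMap.toMatrix' T.toLinearMap * _) _ =
    Matrix.toLin' (_ * LinearMap.toMatrix' T.toLinearMap) _
  rw [Matrix.toLin'_mul, Matrix.toLin'_mul, Matrix.toLin'_toMatrix']
  simp only [LinearMap.comp_apply, Matrix.toLin'_apply, LinearEquiv.coe_coe]
  exact hT g v

theorem mulVec_mem_of_invariant {ρ : G →* Matrix.GeneralLinearGroup (Fin n) K}
    {W : Submodule K (Fin n → K)}
    (hW : ∀ g, ∀ v ∈ W, (ρ g : Matrix (Fin n) (Fin n) K).mulVec v ∈ W)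
    (a : MonoidAlgebra K G) {v : Fin n → K} (hv : v ∈ W) : (evalRep ρ a).mulVec v ∈ W := by
  induction a using MonoidAlgebra.induction_linear with
  | zero => simp
  | add x y hx hy =>
    rw [map_add, Matrix.add_mulVec]
    exact W.add_mem hx hy
  | single g r =>
    rw [evalRep_single, Matrix.smul_mulVec]
    exact W.smul_mem r (hW g v hv)

/-- Central idempotents act by `0` or `1` in an irreducible representation. -/
theorem evalRep_eq_zero_or_one {ρ : G →* Matrix.GeneralLinearGroup (Fin n) K} (h : IsIrred ρ)
    {e : MonoidAlgebra K G} (he : e * e = e) (hc : ∀ b, e * b = b * e) :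
    evalRep ρ e = 0 ∨ evalRep ρ e = 1 := by
  have hP : evalRep ρ e * evalRep ρ e = evalRep ρ e := by rw [← map_mul, he]
  have hcomm : ∀ g, (ρ g : Matrix (Fin n) (Fin n) K) * evalRep ρ e = evalRep ρ e * ρ g := by
    intro g
    have := congrArg (evalRep ρ) (hc (MonoidAlgebra.single g 1))
    simpa using this.symm
  -- The range is invariant because e is central; an idempotent with full range is the identity.
  rcases ((isIrred_iff ρ).1 h).2 (LinearMap.range (Matrix.mulVecLin (evalRep ρ e))) (by
    rintro g _ ⟨v, rfl⟩
    refine ⟨(ρ g : Matrix (Fin n) (Fin n) K).mulVec v, ?_⟩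
    simp [hcomm]) with h0 | h1
  · left
    rw [LinearMap.range_eq_bot] at h0
    apply Matrix.toLin'.injective
    rw [map_zero, Matrix.toLin'_apply']
    exact h0
  · right
    rw [LinearMap.range_eq_top] at h1
    apply Matrix.toLin'.injective
    ext1 i
    ext1
    obtain ⟨v, hv⟩ := h1 (LinearMap.single K (fun _ => K) i 1)
    rw [Matrix.mulVecLin_apply] at hv
    simp only [LinearMap.comp_apply, Matrix.toLin'_apply, Matrix.toLin'_one, LinearMap.id_apply]
    rw [← hv, Matrix.mulVec_mulVec, hP]

variable (K G) in
/-- The evaluation of the group algebra in all the irreducible representations. -/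
noncomputable def evalIrr :
    MonoidAlgebra K G →ₐ[K] Π x : Irr K G, Matrix (Fin x.dim) (Fin x.dim) K :=
  AlgHom.pi fun x => evalRep x.rep

end EvalRep

/-! ### Components of a Wedderburn decomposition are all the irreducibles -/

section Wedderburn

variable {K G ι : Type*} [Field K] [Group G] {d : ι → ℕ}

/-- The matrix representation given by a component of a Wedderburn decomposition. -/
noncomputable def componentRep
    (e : MonoidAlgebra K G ≃ₐ[K] Π i, Matrix (Fin (d i)) (Fin (d i)) K) (i : ι) :
    G →* Matrix.GeneralLinearGroup (Fin (d i)) K :=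
  MonoidHom.toHomUnits
    (((Pi.evalAlgHom K (fun i => Matrix (Fin (d i)) (Fin (d i)) K) i).comp
      e.toAlgHom : _ →* _).comp (MonoidAlgebra.of K G))

theorem evalRep_componentRep
    (e : MonoidAlgebra K G ≃ₐ[K] Π i, Matrix (Fin (d i)) (Fin (d i)) K) (i : ι)
    (a : MonoidAlgebra K G) : evalRep (componentRep e i) a = e a i := by
  have : evalRep (componentRep e i) = (Pi.evalAlgHom K _ i).comp e.toAlgHom := by
    apply MonoidAlgebra.algHom_ext
    · intro g
      simp [componentRep]
    · ext1
  rw [this]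
  rfl

variable [DecidableEq ι]

theorem isIrred_componentRep
    (e : MonoidAlgebra K G ≃ₐ[K] Π i, Matrix (Fin (d i)) (Fin (d i)) K) (i : ι)
    [NeZero (d i)] : IsIrred (componentRep e i) := by
  rw [isIrred_iff]
  refine ⟨NeZero.ne _, fun W hW => ?_⟩
  by_cases h0 : W = ⊥
  · exact Or.inl h0
  right
  obtain ⟨w, hw, hw0⟩ := W.ne_bot_iff.1 h0
  obtain ⟨k, hk⟩ := Function.ne_iff.1 hw0
  rw [eq_top_iff]
  intro u _
  -- This rank-one matrix sends the nonzero w to the arbitrary vector u.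
  obtain ⟨a, ha⟩ := e.surjective (Pi.single i (Matrix.vecMulVec u (Pi.single k (w k)⁻¹)))
  have := mulVec_mem_of_invariant hW a hw
  rw [evalRep_componentRep, ha, Pi.single_eq_same, Matrix.vecMulVec_mulVec] at this
  simpa [inv_mul_cancel₀ hk] using this

/-- Every irreducible representation is a component of a Wedderburn decomposition. -/
theorem exists_mk_componentRep_eq [Fintype ι]
    (e : MonoidAlgebra K G ≃ₐ[K] Π i, Matrix (Fin (d i)) (Fin (d i)) K)
    (hd : ∀ i, NeZero (d i)) {m : ℕ} {ρ : G →* Matrix.GeneralLinearGroup (Fin m) K}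
    (h : IsIrred ρ) :
    ∃ i, Irr.mk (componentRep e i) (isIrred_componentRep e i) = Irr.mk ρ h := by
  let θ : (Π i, Matrix (Fin (d i)) (Fin (d i)) K) →ₐ[K] Matrix (Fin m) (Fin m) K :=
    (evalRep ρ).comp e.symm.toAlgHom
  have hθ : ∀ g : G, θ (e (MonoidAlgebra.single g 1)) = ρ g := by
    intro g
    simp [θ]
  have hm : NeZero m := ⟨((isIrred_iff ρ).1 h).1⟩
  -- The identity is the sum of the diagonal matrix units of all blocks, so they cannot all act by
  -- 0.
  obtain ⟨i, j, hij⟩ : ∃ i j, θ (Pi.single i (Matrix.single j j 1)) ≠ 0 := by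
    by_contra! hcon
    have h1 : (1 : Π i, Matrix (Fin (d i)) (Fin (d i)) K) =
        ∑ i, ∑ j, Pi.single i (Matrix.single j j 1) := by
      conv_lhs => rw [← Finset.univ_sum_single (1 : Π i, Matrix (Fin (d i)) (Fin (d i)) K)]
      refine Finset.sum_congr rfl fun i _ => ?_
      rw [Pi.one_apply, ← Matrix.sum_single_one]
      exact map_sum (AddMonoidHom.single (fun i => Matrix (Fin (d i)) (Fin (d i)) K) i) _ _
    have h2 : (1 : Matrix (Fin m) (Fin m) K) = 0 := by
      rw [← map_one θ, h1, map_sum]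
      exact Finset.sum_eq_zero fun i _ => by
        rw [map_sum]
        exact Finset.sum_eq_zero fun j _ => hcon i j
    exact one_ne_zero h2
  obtain ⟨w, hw⟩ : ∃ w, (θ (Pi.single i (Matrix.single j j 1))).mulVec w ≠ 0 := by
    by_contra! hcon
    apply hij
    apply Matrix.toLin'.injective
    ext1 k
    ext1
    simp only [LinearMap.comp_apply, Matrix.toLin'_apply, hcon, map_zero, LinearMap.zero_apply]
  -- The j-th column of block i is a left ideal isomorphic to the i-th component; applying it to w
  -- gives a nonzero intertwiner, bijective by Schur's lemma.
  let T : (Fin (d i) → K) →ₗ[K] (Fin m → K) :=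
    { toFun := fun u => (θ (Pi.single i (Matrix.vecMulVec u (Pi.single j 1)))).mulVec w
      map_add' := fun u v => by
        rw [Matrix.add_vecMulVec, Pi.single_add, map_add, Matrix.add_mulVec]
      map_smul' := fun c u => by
        rw [Matrix.smul_vecMulVec, Pi.single_smul, map_smul, Matrix.smul_mulVec, RingHom.id_apply] }
  have hTapp : ∀ u, T u = (θ (Pi.single i (Matrix.vecMulVec u (Pi.single j 1)))).mulVec w :=
    fun _ => rfl
  have hT : ∀ g u, T ((componentRep e i g : Matrix _ _ K).mulVec u) =
      (ρ g : Matrix (Fin m) (Fin m) K).mulVec (T u) := by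
    intro g u
    rw [hTapp, hTapp, Matrix.mulVec_mulVec, ← hθ, ← map_mul]
    congr 2
    ext1 k
    by_cases hk : k = i
    · subst hk
      simp [Matrix.mul_vecMulVec, componentRep]
    · simp [hk]
  have hT0 : T (Pi.single j 1) ≠ 0 := by
    rw [hTapp]
    convert hw using 4
    exact (Matrix.single_eq_single_vecMulVec_single j j).symm
  have hker : LinearMap.ker T = ⊥ := by
    refine (((isIrred_iff _).1 (isIrred_componentRep e i)).2 (LinearMap.ker T) ?_).resolve_right ?_
    · intro g v hv
      rw [LinearMap.mem_ker] at hv ⊢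
      rw [hT, hv, Matrix.mulVec_zero]
    · intro htop
      exact hT0 (LinearMap.mem_ker.1 (htop ▸ Submodule.mem_top))
  have hrange : LinearMap.range T = ⊤ := by
    refine (((isIrred_iff _).1 h).2 (LinearMap.range T) ?_).resolve_left ?_
    · rintro g _ ⟨v, rfl⟩
      exact ⟨_, hT g v⟩
    · intro hbot
      rw [LinearMap.range_eq_bot] at hbot
      exact hT0 (by rw [hbot, LinearMap.zero_apply])
  exact ⟨i, mk_eq_mk_of_linearEquiv _ _
    (LinearEquiv.ofBijective T ⟨LinearMap.ker_eq_bot.1 hker, LinearMap.range_eq_top.1 hrange⟩) hT⟩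

end Wedderburn

/-! ### K[G] as the product of matrix algebras over Irr(G) -/

section Decomposition

variable {K G : Type*} [Field K] [IsAlgClosed K] [Group G] [Finite G] [NeZero (Nat.card G : K)]

instance Irr.instFinite : Finite (Irr K G) := by
  obtain ⟨n, d, hd, ⟨e⟩⟩ :=
    IsSemisimpleRing.exists_algEquiv_pi_matrix_of_isAlgClosed K (MonoidAlgebra K G)
  refine Finite.of_surjective
    (fun i : Fin n => Irr.mk (componentRep e i) (isIrred_componentRep e i)) fun x => ?_
  obtain ⟨i, hi⟩ := exists_mk_componentRep_eq e hd x.isIrred_rep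
  exact ⟨i, hi.trans x.mk_rep⟩

/-- An element of the group algebra is determined by its action in the irreducible
representations. -/
theorem eq_of_forall_evalRep_eq {a b : MonoidAlgebra K G}
    (h : ∀ x : Irr K G, evalRep x.rep a = evalRep x.rep b) : a = b := by
  obtain ⟨n, d, hd, ⟨e⟩⟩ :=
    IsSemisimpleRing.exists_algEquiv_pi_matrix_of_isAlgClosed K (MonoidAlgebra K G)
  apply e.injective
  ext1 i
  rw [← evalRep_componentRep, ← evalRep_componentRep]
  exact (Irr.evalRep_mk_eq_iff (isIrred_componentRep e i) a b).1 (h _)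

theorem evalIrr_injective : Function.Injective (evalIrr K G) := fun _ _ h =>
  eq_of_forall_evalRep_eq fun x => congrFun h x

/-- A dimension count: Irr(G) injects into the set of Wedderburn components, so the target is no
larger than K[G], and evaluation is already injective. -/
theorem evalIrr_surjective : Function.Surjective (evalIrr K G) := by
  classical
  have := Fintype.ofFinite (Irr K G)
  obtain ⟨n, d, hd, ⟨e⟩⟩ :=
    IsSemisimpleRing.exists_algEquiv_pi_matrix_of_isAlgClosed K (MonoidAlgebra K G)
  have hs : ∀ x : Irr K G, ∃ i, Irr.mk (componentRep e i) (isIrred_componentRep e i) = x :=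
    fun x => by
      obtain ⟨i, hi⟩ := exists_mk_componentRep_eq e hd x.isIrred_rep
      exact ⟨i, hi.trans x.mk_rep⟩
  choose s hs using hs
  have hdim : ∀ x, x.dim = d (s x) := fun x => by
    conv_lhs => rw [← hs x]
    rfl
  have hinj : Function.Injective s := fun x y hxy => by rw [← hs x, ← hs y, hxy]
  have hle : Module.finrank K (Π x : Irr K G, Matrix (Fin x.dim) (Fin x.dim) K) ≤
      Module.finrank K (MonoidAlgebra K G) := by
    rw [e.toLinearEquiv.finrank_eq, Module.finrank_pi_fintype, Module.finrank_pi_fintype]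
    simp only [Module.finrank_matrix, Module.finrank_self, Fintype.card_fin, hdim]
    exact (Finset.sum_map Finset.univ ⟨s, hinj⟩ fun i => d i * d i * 1).symm.trans_le
      (Finset.sum_le_sum_of_subset (Finset.subset_univ _))
  have hker : LinearMap.ker (evalIrr K G).toLinearMap = ⊥ :=
    LinearMap.ker_eq_bot.2 evalIrr_injective
  have hfin := LinearMap.finrank_range_add_finrank_ker (evalIrr K G).toLinearMap
  rw [hker, finrank_bot, add_zero] at hfin
  have hrange : LinearMap.range (evalIrr K G).toLinearMap = ⊤ :=
    Submodule.eq_top_of_finrank_eq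
      (le_antisymm (Submodule.finrank_le _) (hfin ▸ hle))
  exact LinearMap.range_eq_top.1 hrange

end Decomposition

/-! ### Dimension of a central ideal over K -/

section Dimension

variable {K G : Type*} [Field K] [Group G]

theorem Irr.one_ne_zero_matrix (x : Irr K G) : (1 : Matrix (Fin x.dim) (Fin x.dim) K) ≠ 0 := by
  have : NeZero x.dim := ⟨((isIrred_iff _).1 x.isIrred_rep).1⟩
  exact one_ne_zero

open Classical in
/-- The dimension of the ideal generated by a central idempotent. -/
theorem finrank_fixedBy_eq_sum [IsAlgClosed K] [Finite G] [NeZero (Nat.card G : K)]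
    [Fintype (Irr K G)] {e : MonoidAlgebra K G} (he : e * e = e) (hc : ∀ b, e * b = b * e) :
    Module.finrank K (fixedBy e) = ∑ x : Irr K G with evalRep x.rep e = 1, x.dim ^ 2 := by
  let P : Irr K G → Prop := fun x => evalRep x.rep e = 1
  -- Only the blocks where e acts by 1 are kept: elsewhere a = a e acts by 0.
  let L : fixedBy e →ₗ[K] Π x : {x : Irr K G // P x}, Matrix (Fin x.1.dim) (Fin x.1.dim) K :=
    LinearMap.pi fun x => (evalRep x.1.rep).toLinearMap ∘ₗ (fixedBy e).subtype
  have hL : ∀ a x, L a x = evalRep x.1.rep a := fun _ _ => rfl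
  have hinj : Function.Injective L := by
    rintro ⟨a, ha⟩ ⟨b, hb⟩ hab
    rw [mem_fixedBy] at ha hb
    apply Subtype.ext
    refine eq_of_forall_evalRep_eq fun x => ?_
    rcases evalRep_eq_zero_or_one x.isIrred_rep he hc with h0 | h1
    · change evalRep x.rep a = evalRep x.rep b
      rw [← ha, ← hb, map_mul, map_mul, h0, mul_zero, mul_zero]
    · exact congrFun hab ⟨x, h1⟩
  have hsurj : Function.Surjective L := by
    intro b
    obtain ⟨a, ha⟩ := evalIrr_surjective (K := K) (G := G)
      fun x => if h : P x then b ⟨x, h⟩ else 0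
    have ha' : ∀ x, evalRep x.rep a = if h : P x then b ⟨x, h⟩ else 0 := fun x => congrFun ha x
    refine ⟨⟨a, ?_⟩, ?_⟩
    · rw [mem_fixedBy]
      refine eq_of_forall_evalRep_eq fun x => ?_
      rw [map_mul]
      by_cases h : P x
      · rw [show evalRep x.rep e = 1 from h, mul_one]
      · rw [ha', dif_neg h, zero_mul]
    · ext1 x
      rw [hL, ha', dif_pos x.2]
  rw [(LinearEquiv.ofBijective L ⟨hinj, hsurj⟩).finrank_eq, Module.finrank_pi_fintype]
  simp only [Module.finrank_matrix, Module.finrank_self, Fintype.card_fin, mul_one, ← sq]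
  exact (Finset.sum_subtype _ (by simp [P]) fun x : Irr K G => x.dim ^ 2).symm

end Dimension

/-! ### Extension of scalars from F to K -/

section BaseChange

variable (F K G : Type*) [Field F] [Field K] [Algebra F K] [Group G]

/-- The inclusion `F[G] → K[G]`. -/
noncomputable def extendHom : MonoidAlgebra F G →ₐ[F] MonoidAlgebra K G :=
  MonoidAlgebra.mapAlgHom G (Algebra.ofId F K)

variable {F G}

@[simp] theorem extendHom_single (g : G) (r : F) :
    extendHom F K G (MonoidAlgebra.single g r) = MonoidAlgebra.single g (algebraMap F K r) :=
  MonoidAlgebra.mapAlgHom_single _ _ _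

theorem coeff_extendHom (a : MonoidAlgebra F G) (g : G) :
    (extendHom F K G a).coeff g = algebraMap F K (a.coeff g) :=
  MonoidAlgebra.coeff_mapAlgHom _ _ _

theorem extendHom_injective : Function.Injective (extendHom F K G) := by
  intro a b h
  ext g
  apply (algebraMap F K).injective
  rw [← coeff_extendHom, ← coeff_extendHom, h]

theorem extendHom_invol (a : MonoidAlgebra F G) :
    extendHom F K G (invol a) = invol (extendHom F K G a) := by
  induction a using MonoidAlgebra.induction_linear with
  | zero => simp
  | add x y hx hy => rw [invol_add, map_add, map_add, invol_add, hx, hy]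
  | single g r => simp

theorem single_eq_smul_extendHom (g : G) (r : K) :
    MonoidAlgebra.single g r = r • extendHom F K G (MonoidAlgebra.single g 1) := by
  simp

theorem extendHom_mem_center {e : MonoidAlgebra F G} (hc : ∀ b, e * b = b * e)
    (b : MonoidAlgebra K G) : extendHom F K G e * b = b * extendHom F K G e := by
  induction b using MonoidAlgebra.induction_linear with
  | zero => simp
  | add x y hx hy => rw [mul_add, add_mul, hx, hy]
  | single g r =>
    rw [single_eq_smul_extendHom (F := F), mul_smul_comm, smul_mul_assoc, ← map_mul, ← map_mul, hc]

theorem finrank_fixedBy_add [Finite G] {e : MonoidAlgebra F G} (he : e * e = e) :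
    Module.finrank F (fixedBy e) + Module.finrank F (fixedBy (1 - e)) = Nat.card G := by
  have h1 : fixedBy e = LinearMap.range (LinearMap.mulRight F e) := by
    ext v
    rw [mem_fixedBy, LinearMap.mem_range]
    constructor
    · intro h
      exact ⟨v, h⟩
    · rintro ⟨w, rfl⟩
      simp [mul_assoc, he]
  have h2 : fixedBy (1 - e) = LinearMap.ker (LinearMap.mulRight F e) := by
    ext v
    simp [mul_sub]
  have := Fintype.ofFinite G
  rw [h1, h2, LinearMap.finrank_range_add_finrank_ker,
    (MonoidAlgebra.coeffLinearEquiv F).finrank_eq, Module.finrank_finsupp_self,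
    Nat.card_eq_fintype_card]

/-- An F-basis of F[G]e spans K[G]e over K, since v e is a K-combination of the elements g e. -/
theorem finrank_fixedBy_extendHom_le [Finite G] (e : MonoidAlgebra F G) (he : e * e = e) :
    Module.finrank K (fixedBy (extendHom F K G e)) ≤ Module.finrank F (fixedBy e) := by
  let b := Module.finBasis F (fixedBy e)
  let c := fun i => extendHom F K G (b i)
  have hmem : ∀ w ∈ fixedBy e, extendHom F K G w ∈ Submodule.span K (Set.range c) := by
    intro w hw
    have hsum := congrArg (fun z : fixedBy e => extendHom F K G z) (b.sum_repr ⟨w, hw⟩)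
    simp only [Submodule.coe_sum, Submodule.coe_smul, map_sum, map_smul] at hsum
    rw [← hsum]
    refine Submodule.sum_mem _ fun i _ => ?_
    rw [← algebraMap_smul K]
    exact Submodule.smul_mem _ _ (Submodule.subset_span ⟨i, rfl⟩)
  have hle : fixedBy (extendHom F K G e) ≤ Submodule.span K (Set.range c) := by
    intro v hv
    rw [mem_fixedBy] at hv
    rw [← hv]
    clear hv
    induction v using MonoidAlgebra.induction_linear with
    | zero => simp
    | add x y hx hy =>
      rw [add_mul]
      exact Submodule.add_mem _ hx hy
    | single g r =>
      rw [single_eq_smul_extendHom (F := F), smul_mul_assoc, ← map_mul]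
      refine Submodule.smul_mem _ _ (hmem _ ?_)
      rw [mem_fixedBy, mul_assoc, he]
  calc _ ≤ Module.finrank K (Submodule.span K (Set.range c)) := Submodule.finrank_mono hle
    _ ≤ _ := (finrank_range_le_card c).trans (by rw [Fintype.card_fin])

/-- The inequality holds for both e and 1 - e, and the two dimensions add up to |G| over either
field, so both are equalities. -/
theorem finrank_fixedBy_extendHom [Finite G] {e : MonoidAlgebra F G} (he : e * e = e) :
    Module.finrank K (fixedBy (extendHom F K G e)) = Module.finrank F (fixedBy e) := by
  have h1 := finrank_fixedBy_extendHom_le K e he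
  have h2 := finrank_fixedBy_extendHom_le K (1 - e) (IsIdempotentElem.one_sub he)
  have h3 := finrank_fixedBy_add he
  have h4 := finrank_fixedBy_add (e := extendHom F K G e) (by rw [← map_mul, he])
  rw [map_sub, map_one] at h2
  omega

end BaseChange

/-! ### Galois conjugates and contragredients of central idempotents -/

section Conjugates

variable {F K G : Type*} [Field F] [Field K] [Algebra F K] [Group G]

variable (G) in
/-- The coefficientwise action of the Galois group on `K[G]`. -/
noncomputable def galoisHom (σ : K ≃ₐ[F] K) : MonoidAlgebra K G →ₐ[F] MonoidAlgebra K G :=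
  MonoidAlgebra.mapAlgHom G (σ : K →ₐ[F] K)

theorem coeff_galoisHom (σ : K ≃ₐ[F] K) (a : MonoidAlgebra K G) (g : G) :
    (galoisHom G σ a).coeff g = σ (a.coeff g) :=
  MonoidAlgebra.coeff_mapAlgHom _ _ _

theorem galoisHom_extendHom (σ : K ≃ₐ[F] K) (a : MonoidAlgebra F G) :
    galoisHom G σ (extendHom F K G a) = extendHom F K G a := by
  ext g
  rw [coeff_galoisHom, coeff_extendHom, AlgEquiv.commutes]

theorem evalRep_conj {n : ℕ} (σ : K ≃ₐ[F] K) (ρ : G →* Matrix.GeneralLinearGroup (Fin n) K)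
    (a : MonoidAlgebra K G) : evalRep (conj σ ρ) (galoisHom G σ a) = (evalRep ρ a).map σ := by
  induction a using MonoidAlgebra.induction_linear with
  | zero => simp
  | add x y hx hy =>
    rw [map_add, map_add, map_add, hx, hy, Matrix.map_add σ (map_add σ)]
  | single g r =>
    have : galoisHom G σ (MonoidAlgebra.single g r) = MonoidAlgebra.single g (σ r) :=
      MonoidAlgebra.mapAlgHom_single _ _ _
    rw [this, evalRep_single, evalRep_single]
    ext i j
    simp [conj]

theorem evalRep_smul_eq_iff (σ : K ≃ₐ[F] K) (x : Irr K G) (a b : MonoidAlgebra K G) :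
    evalRep (σ • x).rep (galoisHom G σ a) = evalRep (σ • x).rep (galoisHom G σ b) ↔
      evalRep x.rep a = evalRep x.rep b := by
  obtain ⟨ρ, h, hx⟩ := x.exists_eq_mk
  rw [hx, show σ • Irr.mk ρ h = Irr.mk (conj σ ρ) (isIrred_conj σ h) from rfl,
    Irr.evalRep_mk_eq_iff, Irr.evalRep_mk_eq_iff, evalRep_conj, evalRep_conj]
  exact (Matrix.map_injective σ.injective).eq_iff

theorem evalRep_contra {n : ℕ} (ρ : G →* Matrix.GeneralLinearGroup (Fin n) K)
    (a : MonoidAlgebra K G) : evalRep (contra ρ) a = (evalRep ρ (invol a)).transpose := by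
  induction a using MonoidAlgebra.induction_linear with
  | zero => simp
  | add x y hx hy => rw [map_add, invol_add, map_add, hx, hy, Matrix.transpose_add]
  | single g r =>
    rw [invol_single, evalRep_single, evalRep_single, map_inv]
    rfl

theorem evalRep_contra_eq_iff (x : Irr K G) (a b : MonoidAlgebra K G) :
    evalRep x.contra.rep a = evalRep x.contra.rep b ↔
      evalRep x.rep (invol a) = evalRep x.rep (invol b) := by
  obtain ⟨ρ, h, hx⟩ := x.exists_eq_mk
  rw [hx, show (Irr.mk ρ h).contra = Irr.mk (contra ρ) (isIrred_contra h) from rfl,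
    Irr.evalRep_mk_eq_iff, Irr.evalRep_mk_eq_iff, evalRep_contra, evalRep_contra]
  exact Matrix.transpose_injective.eq_iff

/-- Elements of F[G] are Galois fixed, so the condition depends only on the orbit of x. -/
theorem evalRep_smul_extendHom_eq_one_iff (σ : K ≃ₐ[F] K) (x : Irr K G) (a : MonoidAlgebra F G) :
    evalRep (σ • x).rep (extendHom F K G a) = 1 ↔ evalRep x.rep (extendHom F K G a) = 1 := by
  have := evalRep_smul_eq_iff σ x (extendHom F K G a) 1
  rwa [galoisHom_extendHom, map_one, map_one, map_one] at this

/-- Via the transpose, `invol e` acts by 1 in x exactly when e does in `x.contra`; both idempotents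
are central, so only the values 0 and 1 occur. -/
theorem evalRep_mul_one_sub_invol_eq_one_iff {e : MonoidAlgebra K G} (he : e * e = e)
    (hc : ∀ b, e * b = b * e) (x : Irr K G) :
    evalRep x.rep (e * (1 - invol e)) = 1 ↔
      evalRep x.rep e = 1 ∧ evalRep x.contra.rep e ≠ 1 := by
  have h1 := evalRep_contra_eq_iff x e 1
  rw [map_one, invol_one, map_one] at h1
  rw [h1.ne, map_mul, map_sub, map_one]
  rcases evalRep_eq_zero_or_one x.isIrred_rep he hc with h | h
  · simp [h, x.one_ne_zero_matrix.symm]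
  · rcases evalRep_eq_zero_or_one x.isIrred_rep (e := invol e) (by rw [← invol_mul, he])
      (invol_mem_center hc) with h' | h'
    · simp [h, h', x.one_ne_zero_matrix.symm]
    · simp [h, h', x.one_ne_zero_matrix.symm]

end Conjugates

/-! ### Descent to F and sums over Galois orbits -/

section Orbits

variable {F K G : Type*} [Field F] [Field K] [Algebra F K] [Group G]

variable (F) in
/-- The Galois orbit of an element of `Irr(G)`. -/
def Irr.orbit (x : Irr K G) : IrrOrbit F K G := Quotient.mk'' x

theorem Irr.orbit_smul (σ : K ≃ₐ[F] K) (x : Irr K G) : (σ • x).orbit F = x.orbit F :=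
  Quotient.sound' ⟨σ, rfl⟩

open Classical in
theorem sum_dim_sq_eq_sum_orbits [Fintype (Irr K G)] (S : Finset (IrrOrbit F K G)) :
    ∑ x : Irr K G with x.orbit F ∈ S, x.dim ^ 2 = ∑ o ∈ S, o.size * o.dim ^ 2 := by
  rw [← Finset.sum_fiberwise_of_maps_to (g := fun x : Irr K G => x.orbit F) (t := S)
    (fun x hx => (Finset.mem_filter.1 hx).2)]
  refine Finset.sum_congr rfl fun o ho => ?_
  have hfib : ({x ∈ ({x | x.orbit F ∈ S} : Finset (Irr K G)) | x.orbit F = o} : Finset _) =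
      ({x | x.orbit F = o} : Finset (Irr K G)) := by
    ext x
    simp only [Finset.mem_filter, Finset.mem_univ, true_and, and_iff_right_iff_imp]
    rintro rfl
    exact ho
  have hsize : o.size = Finset.card ({x | x.orbit F = o} : Finset (Irr K G)) := by
    rw [IrrOrbit.size, ← Fintype.card_subtype, ← Nat.card_eq_fintype_card]
    exact Nat.card_congr (Equiv.subtypeEquivRight fun x =>
      MulAction.orbitRel.Quotient.mem_orbit)
  rw [hfib, hsize]
  refine Finset.sum_const_nat fun x hx => ?_
  rw [← (Finset.mem_filter.1 hx).2]
  rfl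

theorem finrank_fixedBy_eq_sum_orbits [IsAlgClosed K] [Finite G] [NeZero (Nat.card G : K)]
    {e : MonoidAlgebra F G} (he : e * e = e) (hc : ∀ b, e * b = b * e)
    (S : Finset (IrrOrbit F K G))
    (hS : ∀ x : Irr K G, evalRep x.rep (extendHom F K G e) = 1 ↔ x.orbit F ∈ S) :
    Module.finrank F (fixedBy e) = ∑ o ∈ S, o.size * o.dim ^ 2 := by
  classical
  have := Fintype.ofFinite (Irr K G)
  rw [← finrank_fixedBy_extendHom K he, ← sum_dim_sq_eq_sum_orbits,
    finrank_fixedBy_eq_sum (by rw [← map_mul, he]) (extendHom_mem_center K hc)]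
  exact Finset.sum_congr (Finset.filter_congr fun x _ => hS x) fun _ _ => rfl

/-- Every set of Galois orbits is the support of a central idempotent of `F[G]`. -/
theorem exists_central_idempotent_of_orbits [IsAlgClosed K] [IsGalois F K] [Finite G]
    [NeZero (Nat.card G : K)] (S : Set (IrrOrbit F K G)) :
    ∃ e : MonoidAlgebra F G, e * e = e ∧ (∀ b, e * b = b * e) ∧
      ∀ x : Irr K G, evalRep x.rep (extendHom F K G e) = 1 ↔ x.orbit F ∈ S := by
  classical
  obtain ⟨ε, hε⟩ := evalIrr_surjective (K := K) (G := G)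
    fun x => if x.orbit F ∈ S then 1 else 0
  have hpos : ∀ x : Irr K G, x.orbit F ∈ S → evalRep x.rep ε = 1 := fun x hx =>
    (congrFun hε x).trans (if_pos hx)
  have hneg : ∀ x : Irr K G, x.orbit F ∉ S → evalRep x.rep ε = 0 := fun x hx =>
    (congrFun hε x).trans (if_neg hx)
  -- The support of ε is a union of orbits, so ε and its conjugate act alike in every irreducible;
  -- its coefficients then lie in the fixed field F.
  have hfix : ∀ σ : K ≃ₐ[F] K, galoisHom G σ ε = ε := by
    intro σ
    refine eq_of_forall_evalRep_eq fun x => ?_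
    obtain ⟨y, rfl⟩ : ∃ y, x = σ • y := ⟨σ⁻¹ • x, (smul_inv_smul σ x).symm⟩
    by_cases hx : y.orbit F ∈ S
    · have := (evalRep_smul_eq_iff σ y ε 1).2 (by rw [hpos y hx, map_one])
      rw [this, map_one, map_one, hpos _ (by rwa [Irr.orbit_smul])]
    · have := (evalRep_smul_eq_iff σ y ε 0).2 (by rw [hneg y hx, map_zero])
      rw [this, map_zero, map_zero, hneg _ (by rwa [Irr.orbit_smul])]
  have hcoeff : ∀ g, ∃ r, algebraMap F K r = ε.coeff g := by
    intro g
    refine (InfiniteGalois.mem_range_algebraMap_iff_fixed (k := F) (ε.coeff g)).2 fun σ => ?_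
    rw [← coeff_galoisHom, hfix]
  choose r hr using hcoeff
  obtain ⟨e, he⟩ : ∃ e, extendHom F K G e = ε := by
    refine ⟨MonoidAlgebra.ofCoeff (Finsupp.equivFunOnFinite.symm r), ?_⟩
    ext g
    rw [coeff_extendHom, ← hr]
    rfl
  refine ⟨e, ?_, fun b => ?_, fun x => ?_⟩
  · apply extendHom_injective K
    rw [map_mul, he]
    refine eq_of_forall_evalRep_eq fun x => ?_
    rw [map_mul]
    by_cases hx : x.orbit F ∈ S
    · rw [hpos x hx, mul_one]
    · rw [hneg x hx, mul_zero]
  · apply extendHom_injective K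
    rw [map_mul, map_mul, he]
    refine eq_of_forall_evalRep_eq fun x => ?_
    rw [map_mul, map_mul]
    by_cases hx : x.orbit F ∈ S
    · rw [hpos x hx, mul_one, one_mul]
    · rw [hneg x hx, mul_zero, zero_mul]
  · rw [he]
    refine ⟨fun h => ?_, hpos x⟩
    by_contra hx
    rw [hneg x hx] at h
    exact x.one_ne_zero_matrix h.symm

end Orbits

/-- The characteristic divides q, so it would be a common divisor if |G| vanished in F. This
supplies Maschke's hypothesis. -/
theorem neZero_card_of_coprime {F G : Type*} [Field F] [Finite F]
    (h : (Nat.card G).Coprime (Nat.card F)) : NeZero (Nat.card G : F) := by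
  obtain ⟨p, hp⟩ := CharP.exists F
  have := Fintype.ofFinite F
  refine ⟨fun h0 => CharP.char_ne_one F p ?_⟩
  rw [CharP.cast_eq_zero_iff F p] at h0
  have h1 : p ∣ Nat.card F := by
    rw [← CharP.cast_eq_zero_iff F p, Nat.card_eq_fintype_card, Nat.cast_card_eq_zero]
  exact Nat.dvd_one.1 (h ▸ Nat.dvd_gcd h0 h1)

end GroupCode

open GroupCode in
theorem theorem1p1 {F K G : Type*} [Field F] [Finite F] [Field K] [Algebra F K] [IsAlgClosure F K]
    [Group G] [Fintype G] (hG : (Nat.card G).Coprime (Nat.card F)) (k : ℕ) (hk : 0 < k) :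
    (∃ C : Ideal (MonoidAlgebra F G), C.IsTwoSided ∧
        Module.finrank F (GroupCode.hull (C.restrictScalars F)) = k) ↔
      ∃ S : Finset (GroupCode.IrrOrbit F K G),
        ∑ x ∈ S, x.size * x.dim ^ 2 = k ∧ ∀ x ∈ S, x.contra ∉ S := by
  classical
  have hF : NeZero (Nat.card G : F) := neZero_card_of_coprime hG
  have hK : NeZero (Nat.card G : K) := by
    rw [← map_natCast (algebraMap F K)]
    exact ⟨(map_ne_zero _).2 hF.out⟩
  have : IsAlgClosed K := IsAlgClosure.isAlgClosed F
  have : Algebra.IsAlgebraic F K := IsAlgClosure.isAlgebraic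
  -- Separability comes from F being perfect, normality from K being an algebraic closure.
  have : IsGalois F K := {}
  have : Finite (IrrOrbit F K G) := Quotient.finite _
  have := Fintype.ofFinite (IrrOrbit F K G)
  -- Shared by both directions: the orbits in the hull are those in the support of e whose
  -- contragredient is outside it.
  have hull_idem : ∀ e : MonoidAlgebra F G, e * e = e → (∀ b, e * b = b * e) →
      ∀ S : Finset (IrrOrbit F K G),
      (∀ x : Irr K G, x.orbit F ∈ S ↔ evalRep x.rep (extendHom F K G e) = 1 ∧
        evalRep x.contra.rep (extendHom F K G e) ≠ 1) →
      Module.finrank F (hull (fixedBy e)) = ∑ o ∈ S, o.size * o.dim ^ 2 := by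
    intro e he hc S hS
    have hi : (1 - invol e) * (1 - invol e) = 1 - invol e :=
      IsIdempotentElem.one_sub (by rw [IsIdempotentElem, ← invol_mul, he])
    rw [hull_fixedBy he hc]
    refine finrank_fixedBy_eq_sum_orbits (K := K) ?_ (fun b => ?_) S fun x => ?_
    · rw [mul_assoc, ← mul_assoc _ e, ← hc, mul_assoc e, hi, ← mul_assoc, he]
    · rw [mul_assoc, sub_mul, invol_mem_center hc, one_mul, ← mul_assoc b, ← hc, mul_assoc,
        mul_sub, mul_sub, mul_sub, mul_one]
    · rw [hS, map_mul, map_sub, map_one, extendHom_invol]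
      exact evalRep_mul_one_sub_invol_eq_one_iff (by rw [← map_mul, he])
        (extendHom_mem_center K hc) x
  constructor
  · rintro ⟨C, hC, hdim⟩
    obtain ⟨e, he, hc, hmem⟩ := exists_central_idempotent C
    have hCe : C.restrictScalars F = fixedBy e := by
      ext v
      rw [Submodule.restrictScalars_mem, hmem, mem_fixedBy]
    let S : Finset (IrrOrbit F K G) := {o | ∃ x : Irr K G, x.orbit F = o ∧
      evalRep x.rep (extendHom F K G e) = 1 ∧ evalRep x.contra.rep (extendHom F K G e) ≠ 1}
    have hS : ∀ x : Irr K G, x.orbit F ∈ S ↔ evalRep x.rep (extendHom F K G e) = 1 ∧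
        evalRep x.contra.rep (extendHom F K G e) ≠ 1 := by
      intro x
      simp only [S, Finset.mem_filter, Finset.mem_univ, true_and]
      refine ⟨?_, fun h => ⟨x, rfl, h⟩⟩
      rintro ⟨y, hy, h⟩
      obtain ⟨σ, rfl⟩ := Quotient.exact' hy
      change evalRep (σ • x).rep _ = 1 ∧ evalRep (σ • x).contra.rep _ ≠ 1 at h
      rwa [Irr.contra_smul, Ne, evalRep_smul_extendHom_eq_one_iff,
        evalRep_smul_extendHom_eq_one_iff] at h
    refine ⟨S, ?_, fun o ho hco => ?_⟩
    · rw [← hull_idem e he hc S hS, ← hCe, hdim]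
    -- Membership of [x] says that e does not act by 1 in `x.contra`; membership of [x*] says that
    -- it does.
    · induction o using Quotient.inductionOn' with
      | h x => exact ((hS x).1 ho).2 ((hS x.contra).1 hco).1
  · rintro ⟨S, hsum, hS⟩
    obtain ⟨e, he, hc, heS⟩ := exists_central_idempotent_of_orbits (S : Set (IrrOrbit F K G))
    have hmem : ∀ v, v ∈ Ideal.span {e} ↔ v * e = v := by
      intro v
      rw [Ideal.mem_span_singleton']
      constructor
      · rintro ⟨a, rfl⟩
        rw [mul_assoc, he]
      · intro h
        exact ⟨v, h⟩
    refine ⟨Ideal.span {e}, ⟨fun {a} b ha => ?_⟩, ?_⟩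
    · rw [hmem] at ha ⊢
      rw [mul_assoc, ← hc, ← mul_assoc, ha]
    · have hCe : (Ideal.span {e}).restrictScalars F = fixedBy e := by
        ext v
        rw [Submodule.restrictScalars_mem, hmem, mem_fixedBy]
      -- The support of e is S itself, and condition 2 removes nothing from it, so S also describes
      -- the hull.
      rw [hCe, hull_idem e he hc S fun x => ?_, hsum]
      rw [heS, Ne, heS]
      exact ⟨fun h => ⟨h, hS _ h⟩, And.left⟩
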